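/- All graphs are finite and simple. A graph is subcubic if its maximum degree is at most $3$, and outerplanar if it admits an embedding in the plane in which every vertex lies on the boundary of the outer (unbounded) face. A $2$-tone $5$-coloring of a graph $G$ is a function $f$ assigning to each vertex a $2$-element subset of $\{1,2,3,4,5\}$ such that $|f(u)\cap f(v)| < d_G(u,v)$ for all distinct vertices $u,v$ of $G$, where $d_G(u,v)$ is the distance in $G$ (infinite if $u$ and $v$ lie in different components). Theorem. Let $G$ be a subcubic outerplanar graph. Then $G$ has a $2$-tone $5$-coloring if and only if $G$ contains none of the cycles $C_3$, $C_4$, $C_7$ as a (not necessarily induced) subgraph. -/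

import Mathlib

/-- A `t`-tone `k`-coloring of `G`: every vertex gets a set of exactly `t` of the `k` colors, and
distinct vertices `u`, `v` have fewer than `d(u, v)` common colors. The distance is the extended
one, so that it is infinite (no constraint) for vertices in different components. -/
def SimpleGraph.IsToneColoring {V : Type*} (G : SimpleGraph V) (t k : ℕ)
    (f : V → Finset (Fin k)) : Prop :=
  (∀ v, (f v).card = t) ∧
    ∀ u v, u ≠ v → ((f u ∩ f v).card : ℕ∞) < G.edist u v

/-- `G` is `t`-tone `k`-colorable. -/
def SimpleGraph.ToneColorable {V : Type*} (G : SimpleGraph V) (t k : ℕ) : Prop :=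
  ∃ f : V → Finset (Fin k), G.IsToneColoring t k f

/-- An embedding of `G` in the Euclidean plane (here `ℂ`): the vertices are distinct points, every
edge is a simple arc joining its two endpoints, an arc passes through no other vertex, and two
distinct arcs meet at most in a common endpoint. Values of `arc` outside `G.edgeSet` are
irrelevant. -/
structure SimpleGraph.PlaneEmbedding {V : Type*} (G : SimpleGraph V) where
  /-- the position of each vertex -/
  pos : V → ℂ
  /-- the point set of the arc representing each edge -/
  arc : Sym2 V → Set ℂ
  pos_injective : Function.Injective pos
  arc_simple : ∀ u v, G.Adj u v →
    ∃ γ : _root_.Path (pos u) (pos v), Function.Injective γ ∧ Set.range γ = arc s(u, v)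
  mem_of_pos_mem_arc : ∀ w, ∀ e ∈ G.edgeSet, pos w ∈ arc e → w ∈ e
  arc_inter_arc : ∀ e ∈ G.edgeSet, ∀ e' ∈ G.edgeSet, e ≠ e' →
    ∀ z ∈ arc e, z ∈ arc e' → ∃ v, v ∈ e ∧ v ∈ e' ∧ pos v = z

/-- The point set of the drawing: all vertices and all arcs of edges. -/
def SimpleGraph.PlaneEmbedding.drawing {V : Type*} {G : SimpleGraph V}
    (E : G.PlaneEmbedding) : Set ℂ :=
  Set.range E.pos ∪ ⋃ e ∈ G.edgeSet, E.arc e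

/-- The faces are the connected components of the complement of the drawing. -/
def SimpleGraph.PlaneEmbedding.IsFace {V : Type*} {G : SimpleGraph V}
    (E : G.PlaneEmbedding) (F : Set ℂ) : Prop :=
  ∃ z ∈ E.drawingᶜ, F = connectedComponentIn E.drawingᶜ z

/-- The outer face is the unbounded face. -/
def SimpleGraph.PlaneEmbedding.IsOuterFace {V : Type*} {G : SimpleGraph V}
    (E : G.PlaneEmbedding) (F : Set ℂ) : Prop :=
  E.IsFace F ∧ ¬ Bornology.IsBounded F

/-- `G` is outerplanar: it has an embedding in the plane in which every vertex lies on the boundary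
of the outer face. -/
def SimpleGraph.IsOuterplanar {V : Type*} (G : SimpleGraph V) : Prop :=
  ∃ E : G.PlaneEmbedding, ∃ F : Set ℂ, E.IsOuterFace F ∧ ∀ v, E.pos v ∈ frontier F

/-! The 2-subsets of five colors, adjacent when disjoint, form the Petersen graph, and a 2-tone
5-coloring is the same thing as a locally injective homomorphism to it
(`toneColorable_two_five_iff`). On a cycle, such a map is a closed walk that never backtracks; the
Petersen graph has these in every length at least 5 except 7, and in no smaller length. This gives
necessity, and colors chordless cycles of the allowed lengths.

Sufficiency is by induction over subgraphs on a fixed vertex set. The Petersen graph is cubic and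
3-arc-transitive, so after a permutation of the colors, colorings fit together across a bridge or
along a chord. In a bridgeless graph a longest cycle fills its component (`mem_support_of_adj`) and
its chords do not cross (`not_adj_of_chord`), so either a chord separates the component or the cycle
is chordless.

Planarity enters only by excluding subdivisions of `K₂,₃` (`IsOuterplanar.not_exists_walks`): a
point of the outer face, joined to the three middle vertices, would complete a drawing of `K₃,₃` in
which independent edges are disjoint. A parity count of logarithm increments forbids this
(`not_exists_independent_K33_drawing`). -/

/-! ### Logarithm increments and the drawing obstruction for `K₃,₃` -/

/-- A nowhere vanishing continuous function on a contractible, locally path-connected space has a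
continuous logarithm. -/
theorem Complex.exists_continuous_log {A : Type*} [TopologicalSpace A] [ContractibleSpace A]
    [LocallyPathConnectedSpace A] {f : A → ℂ} (hf : Continuous f) (h0 : ∀ x, f x ≠ 0) :
    ∃ L : A → ℂ, Continuous L ∧ ∀ x, Complex.exp (L x) = f x := by
  obtain ⟨x₀⟩ : Nonempty A := inferInstance
  obtain ⟨F, ⟨-, hF⟩, -⟩ := Complex.isCoveringMapOn_exp.existsUnique_continuousMap_lifts ⟨f, hf⟩
    (Complex.exp_log (h0 x₀)) (fun x ↦ h0 x)
  exact ⟨F, F.continuous, fun x ↦ congrFun hF x⟩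

/-- Two continuous logarithms of the same curve have the same increment. -/
theorem Complex.log_increment_unique {L L' : ℝ → ℂ} (hL : Continuous L) (hL' : Continuous L')
    (h : ∀ t, Complex.exp (L t) = Complex.exp (L' t)) : L 1 - L 0 = L' 1 - L' 0 := by
  have key := Complex.isCoveringMapOn_exp.existsUnique_continuousMap_lifts
    (⟨fun t ↦ Complex.exp (L t), by fun_prop⟩ : C(ℝ, ℂ)) (a₀ := 0) (e₀ := L 0) rfl
    (fun t ↦ Complex.exp_ne_zero _)
  have h1 := key.unique (y₁ := ⟨L, hL⟩) (y₂ := ⟨fun t ↦ L' t + (L 0 - L' 0), by fun_prop⟩)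
    ⟨rfl, rfl⟩ ⟨by simp, by
      funext t
      simp [Complex.exp_add, Complex.exp_sub, h]⟩
  have h2 := congrArg (fun g : C(ℝ, ℂ) ↦ g 1) h1
  simp only [ContinuousMap.coe_mk] at h2
  rw [h2]; ring

/-- The increment over `[0, 1]` of a continuous logarithm of the curve `γ`. -/
noncomputable def logIncrement (γ : ℝ → ℂ) : ℂ :=
  open Classical in
  if h : ∃ L : ℝ → ℂ, Continuous L ∧ ∀ t, Complex.exp (L t) = γ t then
    h.choose 1 - h.choose 0 else 0

theorem logIncrement_eq {γ L : ℝ → ℂ} (hL : Continuous L) (h : ∀ t, Complex.exp (L t) = γ t) :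
    logIncrement γ = L 1 - L 0 := by
  have hex : ∃ L : ℝ → ℂ, Continuous L ∧ ∀ t, Complex.exp (L t) = γ t := ⟨L, hL, h⟩
  rw [logIncrement, dif_pos hex]
  exact Complex.log_increment_unique hex.choose_spec.1 hL
    fun t ↦ (hex.choose_spec.2 t).trans (h t).symm

theorem exp_logIncrement {γ : ℝ → ℂ} (hγ : Continuous γ) (h0 : ∀ t, γ t ≠ 0) :
    Complex.exp (logIncrement γ) = γ 1 / γ 0 := by
  obtain ⟨L, hL, h⟩ := Complex.exists_continuous_log hγ h0
  rw [logIncrement_eq hL h, Complex.exp_sub, h, h]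

/-- The difference `γ s - η t` has a continuous logarithm on the whole plane of parameters, and both
sides are its alternating sum over the corners of the unit square. Reversing the sign of the
difference shifts the logarithm by `π i`, which drops out of increments. -/
theorem logIncrement_sub_comm {γ η : ℝ → ℂ} (hγ : Continuous γ) (hη : Continuous η)
    (h : ∀ s t, γ s ≠ η t) :
    logIncrement (fun s ↦ γ s - η 1) - logIncrement (fun s ↦ γ s - η 0) =
      logIncrement (fun t ↦ η t - γ 1) - logIncrement (fun t ↦ η t - γ 0) := by
  obtain ⟨L, hL, hexp⟩ := Complex.exists_continuous_log
    (f := fun x : ℝ × ℝ ↦ γ x.1 - η x.2) (by fun_prop) (fun x ↦ sub_ne_zero.2 (h _ _))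
  have h1 (t : ℝ) : logIncrement (fun s ↦ γ s - η t) = L (1, t) - L (0, t) :=
    logIncrement_eq (L := fun s ↦ L (s, t)) (by fun_prop) fun s ↦ hexp (s, t)
  have h2 (s : ℝ) : logIncrement (fun t ↦ η t - γ s) = L (s, 1) - L (s, 0) := by
    rw [logIncrement_eq (L := fun t ↦ L (s, t) + Real.pi * Complex.I) (by fun_prop) fun t ↦ by
      rw [Complex.exp_add, hexp, Complex.exp_pi_mul_I]; ring]
    ring
  rw [h1, h1, h2, h2]; ring

/-- In every drawing of `K₃,₃` by continuous curves, two independent edges meet. -/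
theorem not_exists_independent_K33_drawing {a p : Fin 3 → ℂ} {γ : Fin 3 → Fin 3 → ℝ → ℂ}
    (hc : ∀ i j, Continuous (γ i j)) (h0 : ∀ i j, γ i j 0 = a i) (h1 : ∀ i j, γ i j 1 = p j)
    (hd : ∀ i i' j j', i ≠ i' → j ≠ j' → ∀ s t, γ i j s ≠ γ i' j' t) : False := by
  have hne : ∀ i : Fin 3, ∃ i', i ≠ i' := by decide
  have hap (i j) : a i - p j ≠ 0 := by
    obtain ⟨i', hi⟩ := hne i
    obtain ⟨j', hj⟩ := hne j
    have := hd i i' j' j hi hj.symm 0 1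
    rwa [h0, h1, ← sub_ne_zero] at this
  have ha (i i') (hi : i ≠ i') : a i - a i' ≠ 0 := by
    have := hd i i' 0 1 hi (by decide) 0 0
    rwa [h0, h0, ← sub_ne_zero] at this
  have hp (j j') (hj : j ≠ j') : p j - p j' ≠ 0 := by
    have := hd 0 1 j j' (by decide) hj 1 1
    rwa [h1, h1, ← sub_ne_zero] at this
  have anti (z : ℂ) (hz : z ≠ 0) :
      ∃ n : ℤ, Complex.log (-z) - Complex.log z = (2 * n + 1) * (Real.pi * Complex.I) := by
    have : Complex.exp (Complex.log (-z)) = Complex.exp (Complex.log z + Real.pi * Complex.I) := by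
      rw [Complex.exp_add, Complex.exp_log hz, Complex.exp_log (neg_ne_zero.2 hz),
        Complex.exp_pi_mul_I]
      ring
    obtain ⟨n, hn⟩ := Complex.exp_eq_exp_iff_exists_int.1 this
    exact ⟨n, by rw [hn]; ring⟩
  have hα (i i') : ∃ n : ℤ, i ≠ i' → Complex.log (a i' - a i) - Complex.log (a i - a i') =
      (2 * n + 1) * (Real.pi * Complex.I) := by
    by_cases hi : i = i'
    · exact ⟨0, fun h ↦ absurd hi h⟩
    · obtain ⟨n, hn⟩ := anti _ (ha i i' hi)
      exact ⟨n, fun _ ↦ by simpa using hn⟩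
  have hβ (j j') : ∃ n : ℤ, j ≠ j' → Complex.log (p j' - p j) - Complex.log (p j - p j') =
      (2 * n + 1) * (Real.pi * Complex.I) := by
    by_cases hj : j = j'
    · exact ⟨0, fun h ↦ absurd hj h⟩
    · obtain ⟨n, hn⟩ := anti _ (hp j j' hj)
      exact ⟨n, fun _ ↦ by simpa using hn⟩
  have hn (i j j') : ∃ n : ℤ, j ≠ j' → logIncrement (fun s ↦ γ i j s - p j') =
      Complex.log (p j - p j') - Complex.log (a i - p j') + n * (2 * Real.pi * Complex.I) := by
    by_cases hj : j = j'
    · exact ⟨0, fun h ↦ absurd hj h⟩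
    obtain ⟨i', hi⟩ := hne i
    have hx (s) : γ i j s - p j' ≠ 0 := by
      rw [sub_ne_zero, ← h1 i' j']; exact hd i i' j j' hi hj s 1
    have := exp_logIncrement (γ := fun s ↦ γ i j s - p j') (by have := hc i j; fun_prop) hx
    simp only [h0, h1] at this
    rw [← Complex.exp_log (hp j j' hj), ← Complex.exp_log (hap i j'), ← Complex.exp_sub] at this
    obtain ⟨n, hn⟩ := Complex.exp_eq_exp_iff_exists_int.1 this
    exact ⟨n, fun _ ↦ hn⟩
  -- The reference logarithm of `p j - a i'` is taken to be that of `a i' - p j` plus `π i`, so that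
  -- the logarithms of differences `a - p` cancel in `key`.
  have hm (i j i') : ∃ n : ℤ, i ≠ i' → logIncrement (fun s ↦ γ i j s - a i') =
      Complex.log (a i' - p j) + Real.pi * Complex.I - Complex.log (a i - a i')
        + n * (2 * Real.pi * Complex.I) := by
    by_cases hi : i = i'
    · exact ⟨0, fun h ↦ absurd hi h⟩
    obtain ⟨j', hj⟩ := hne j
    have hx (s) : γ i j s - a i' ≠ 0 := by
      rw [sub_ne_zero, ← h0 i' j']; exact hd i i' j j' hi hj s 0
    have := exp_logIncrement (γ := fun s ↦ γ i j s - a i') (by have := hc i j; fun_prop) hx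
    simp only [h0, h1] at this
    have e : p j - a i' = Complex.exp (Complex.log (a i' - p j) + Real.pi * Complex.I) := by
      rw [Complex.exp_add, Complex.exp_log (hap i' j), Complex.exp_pi_mul_I]; ring
    rw [e, ← Complex.exp_log (ha i i' hi), ← Complex.exp_sub] at this
    obtain ⟨n, hn⟩ := Complex.exp_eq_exp_iff_exists_int.1 this
    exact ⟨n, fun _ ↦ hn⟩
  choose α hα using hα
  choose β hβ using hβ
  choose n hn using hn
  choose m hm using hm
  have key (i i' j j') (hi : i ≠ i') (hj : j ≠ j') :
      (2 * α i i' + 1) + (2 * β j j' + 1) =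
        2 * (n i j j' - n i' j' j - m i j i' + m i' j' i) := by
    have := logIncrement_sub_comm (hc i j) (hc i' j') (hd i i' j j' hi hj)
    simp only [h0, h1] at this
    rw [hn i j j' hj, hn i' j' j hj.symm, hm i j i' hi, hm i' j' i hi.symm] at this
    have hpi : (Real.pi * Complex.I : ℂ) ≠ 0 := by simp [Real.pi_ne_zero]
    have e : ((2 * α i i' + 1 : ℂ) + (2 * β j j' + 1)) * (Real.pi * Complex.I) =
        2 * (n i j j' - n i' j' j - m i j i' + m i' j' i) * (Real.pi * Complex.I) := by
      linear_combination -this - hα i i' hi - hβ j j' hj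
    exact_mod_cast mul_right_cancel₀ hpi e
  have hββ (j j') (hj : j ≠ j') : (2 * β j j' + 1) + (2 * β j' j + 1) = 0 := by
    have hpi : (Real.pi * Complex.I : ℂ) ≠ 0 := by simp [Real.pi_ne_zero]
    have e : ((2 * β j j' + 1 : ℂ) + (2 * β j' j + 1)) * (Real.pi * Complex.I) =
        0 * (Real.pi * Complex.I) := by
      linear_combination - hβ j j' hj - hβ j' j hj.symm
    exact_mod_cast mul_right_cancel₀ hpi e
  -- Add `key`, halved, over the 18 pairs of independent edges. Modulo 2 every `n` and `m` occurs
  -- twice and every `α` six times, so these vanish. Each `β j j'` occurs three times, and `β j j' +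
  -- β j' j = -1`; the left sides therefore total `18 - 9` up to even terms, which is odd.
  have b1 := hββ 0 1 (by decide)
  have b2 := hββ 0 2 (by decide)
  have b3 := hββ 1 2 (by decide)
  have k (i i' j j') (hi : i ≠ i' := by decide) (hj : j ≠ j' := by decide) := key i i' j j' hi hj
  have := k 0 1 0 1
  have := k 0 1 0 2
  have := k 0 1 1 0
  have := k 0 1 1 2
  have := k 0 1 2 0
  have := k 0 1 2 1
  have := k 0 2 0 1
  have := k 0 2 0 2
  have := k 0 2 1 0
  have := k 0 2 1 2
  have := k 0 2 2 0
  have := k 0 2 2 1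
  have := k 1 2 0 1
  have := k 1 2 0 2
  have := k 1 2 1 0
  have := k 1 2 1 2
  have := k 1 2 2 0
  have := k 1 2 2 1
  omega

/-! ### Plane drawings and the exclusion of `K₂,₃` -/

namespace SimpleGraph

namespace PlaneEmbedding

variable {V : Type*} {G : SimpleGraph V} (E : G.PlaneEmbedding)

/-- The part of the drawing that belongs to the subgraph induced on `S`. -/
def trace (S : Set V) : Set ℂ :=
  E.pos '' S ∪ ⋃ e ∈ {e ∈ G.edgeSet | ∀ v ∈ e, v ∈ S}, E.arc e

theorem trace_mono {S T : Set V} (h : S ⊆ T) : E.trace S ⊆ E.trace T := by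
  refine Set.union_subset_union (Set.image_mono h) (Set.biUnion_subset_biUnion_left ?_)
  exact fun e he ↦ ⟨he.1, fun v hv ↦ h (he.2 v hv)⟩

theorem trace_subset_drawing (S : Set V) : E.trace S ⊆ E.drawing :=
  Set.union_subset_union (Set.image_subset_range _ _)
    (Set.biUnion_subset_biUnion_left fun _ he ↦ he.1)

theorem arc_subset_trace {S : Set V} {u v : V} (h : G.Adj u v) (hu : u ∈ S) (hv : v ∈ S) :
    E.arc s(u, v) ⊆ E.trace S := by
  intro z hz
  refine Or.inr (Set.mem_biUnion (x := s(u, v)) ⟨h, fun w hw ↦ ?_⟩ hz)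
  rcases Sym2.mem_iff.1 hw with rfl | rfl <;> assumption

theorem mem_of_pos_mem_trace {S : Set V} {v : V} (h : E.pos v ∈ E.trace S) : v ∈ S := by
  rcases h with ⟨w, hw, hwv⟩ | h
  · exact E.pos_injective hwv ▸ hw
  · simp only [Set.mem_iUnion] at h
    obtain ⟨e, he, h⟩ := h
    exact he.2 v (E.mem_of_pos_mem_arc v e he.1 h)

/-- Two distinct arcs meet only at a common endpoint, which would lie in both vertex sets; a single
edge cannot have its endpoints in both. -/
theorem disjoint_trace {S T : Set V} (h : Disjoint S T) : Disjoint (E.trace S) (E.trace T) := by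
  rw [Set.disjoint_left] at h ⊢
  rintro z hS hT
  rcases hS with ⟨v, hv, rfl⟩ | hS
  · exact h hv (E.mem_of_pos_mem_trace hT)
  rcases hT with ⟨v, hv, rfl⟩ | hT
  · exact h (E.mem_of_pos_mem_trace (Or.inr hS)) hv
  simp only [Set.mem_iUnion] at hS hT
  obtain ⟨e, he, heS⟩ := hS
  obtain ⟨e', he', heT⟩ := hT
  by_cases hee : e = e'
  · subst hee
    exact h (he.2 _ e.out_fst_mem) (he'.2 _ e.out_fst_mem)
  · obtain ⟨v, hv, hv', -⟩ := E.arc_inter_arc e he.1 e' he'.1 hee z heS heT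
    exact h (he.2 v hv) (he'.2 v hv')

theorem isCompact_arc {e : Sym2 V} (he : e ∈ G.edgeSet) : IsCompact (E.arc e) := by
  induction e with
  | h u v =>
    obtain ⟨γ, -, hγ⟩ := E.arc_simple u v he
    rw [← hγ]
    exact isCompact_range γ.continuous

theorem isClosed_trace [Finite V] (S : Set V) : IsClosed (E.trace S) := by
  refine (((Set.toFinite S).image _).isCompact.union ?_).isClosed
  exact (Set.toFinite _).isCompact_biUnion fun e he ↦ E.isCompact_arc he.1

theorem isClosed_drawing [Finite V] : IsClosed E.drawing := by
  refine ((Set.finite_range _).isCompact.union ?_).isClosed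
  exact (Set.toFinite _).isCompact_biUnion fun e he ↦ E.isCompact_arc he

theorem exists_path_of_walk {u v : V} (w : G.Walk u v) :
    ∃ γ : _root_.Path (E.pos u) (E.pos v), Set.range γ ⊆ E.trace {x | x ∈ w.support} := by
  induction w with
  | nil => exact ⟨.refl _, by simp [trace]⟩
  | @cons u v w h p ih =>
    obtain ⟨γ, hγ⟩ := ih
    obtain ⟨δ, -, hδ⟩ := E.arc_simple u v h
    refine ⟨δ.trans γ, ?_⟩
    rw [Path.trans_range, hδ]
    refine Set.union_subset (E.arc_subset_trace h (by simp) (by simp)) (hγ.trans ?_)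
    exact E.trace_mono fun x hx ↦ by simp_all

/-- The face is open and connected, hence path connected. A small ball around the vertex misses the
closed set `E.trace S`, and the face enters that ball; the path runs through the face and then
inside the ball, where it may touch other parts of the drawing. -/
theorem exists_path_to_frontier [Finite V] {F : Set ℂ} (hF : E.IsFace F) {z : ℂ} (hz : z ∈ F)
    {v : V} (hv : E.pos v ∈ frontier F) {S : Set V} (hS : v ∉ S) :
    ∃ γ : _root_.Path z (E.pos v), Disjoint (Set.range γ) (E.trace S) := by
  obtain ⟨z₀, hz₀, rfl⟩ := hF
  have hopen : IsOpen (connectedComponentIn E.drawingᶜ z₀) :=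
    E.isClosed_drawing.isOpen_compl.connectedComponentIn
  have hconn : IsPathConnected (connectedComponentIn E.drawingᶜ z₀) :=
    hopen.isConnected_iff_isPathConnected.1 (isConnected_connectedComponentIn_iff.2 hz₀)
  have hnhds : (E.trace S)ᶜ ∈ nhds (E.pos v) :=
    (E.isClosed_trace S).isOpen_compl.mem_nhds fun h ↦ hS (E.mem_of_pos_mem_trace h)
  obtain ⟨δ, hδ, hball⟩ := Metric.mem_nhds_iff.1 hnhds
  obtain ⟨q, hq, hqv⟩ := Metric.mem_closure_iff.1 (frontier_subset_closure hv) δ hδ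
  have h1 := hconn.joinedIn z hz q hq
  have h2 : JoinedIn (Metric.ball (E.pos v) δ) q (E.pos v) :=
    ((convex_ball _ _).isPathConnected ⟨_, Metric.mem_ball_self hδ⟩).joinedIn q
      (by rwa [Metric.mem_ball, _root_.dist_comm]) _ (Metric.mem_ball_self hδ)
  have h3 : JoinedIn (E.trace S)ᶜ z (E.pos v) := by
    refine (h1.mono fun x hx ↦ ?_).trans (h2.mono hball)
    exact fun h ↦ connectedComponentIn_subset _ _ hx (E.trace_subset_drawing S h)
  refine ⟨h3.somePath, Set.disjoint_left.2 ?_⟩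
  rintro _ ⟨t, rfl⟩
  exact h3.somePath_mem t

end PlaneEmbedding

/-- An outerplanar graph has no subdivision of `K₂,₃`, even in the following weak form. -/
theorem IsOuterplanar.not_exists_walks {V : Type*} [Finite V] {G : SimpleGraph V}
    (hG : G.IsOuterplanar) {a b : V} {p : Fin 3 → V} (A : ∀ j, G.Walk a (p j))
    (B : ∀ j, G.Walk b (p j)) (hAB : ∀ i j, i ≠ j → (A i).support.Disjoint (B j).support) :
    False := by
  obtain ⟨E, F, ⟨hF, -⟩, hfr⟩ := hG
  obtain ⟨z, hz⟩ : F.Nonempty := by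
    obtain ⟨z, hz, rfl⟩ := hF
    exact ⟨z, mem_connectedComponentIn hz⟩
  have hAB' (i j) (hij : i ≠ j) : Disjoint {x | x ∈ (A i).support} {x | x ∈ (B j).support} :=
    Set.disjoint_left.2 fun x hx hx' ↦ hAB i j hij hx hx'
  choose α hα using fun j ↦ E.exists_path_of_walk (A j)
  choose β hβ using fun j ↦ E.exists_path_of_walk (B j)
  -- The walks to be avoided are those with index other than `j`, which give the edges of `K₃,₃`
  -- independent of the one from `z` to `p j`. The vertex `p j` is on none of them, being the end of
  -- both `A j` and `B j`.
  choose γ hγ using fun j ↦ E.exists_path_to_frontier hF hz (hfr (p j))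
    (S := {x | ∃ i, i ≠ j ∧ (x ∈ (A i).support ∨ x ∈ (B i).support)}) (by
      rintro ⟨i, hij, h | h⟩
      · exact hAB i j hij h (B j).end_mem_support
      · exact hAB j i hij.symm (A j).end_mem_support h)
  have dαβ (i j) (hij : i ≠ j) : Disjoint (Set.range (α i)) (Set.range (β j)) :=
    (E.disjoint_trace (hAB' i j hij)).mono (hα i) (hβ j)
  have dαγ (i j) (hij : i ≠ j) : Disjoint (Set.range (α i)) (Set.range (γ j)) :=
    Set.disjoint_of_subset_left ((hα i).trans (E.trace_mono fun x hx ↦ by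
      exact ⟨i, hij, Or.inl hx⟩)) (hγ j).symm
  have dβγ (i j) (hij : i ≠ j) : Disjoint (Set.range (β i)) (Set.range (γ j)) :=
    Set.disjoint_of_subset_left ((hβ i).trans (E.trace_mono fun x hx ↦ by
      exact ⟨i, hij, Or.inr hx⟩)) (hγ j).symm
  have mem {x y : ℂ} (δ : _root_.Path x y) (t : ℝ) : δ.extend t ∈ Set.range δ :=
    δ.extend_range ▸ Set.mem_range_self t
  refine not_exists_independent_K33_drawing (a := ![E.pos a, E.pos b, z]) (p := E.pos ∘ p)
    (γ := ![fun j ↦ (α j).extend, fun j ↦ (β j).extend, fun j ↦ (γ j).extend]) ?_ ?_ ?_ ?_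
  · intro i j
    fin_cases i <;> exact Path.continuous_extend _
  · intro i j
    fin_cases i <;> exact Path.extend_zero _
  · intro i j
    fin_cases i <;> exact Path.extend_one _
  · intro i i' j j' hi hj s t
    fin_cases i <;> fin_cases i' <;> first | exact absurd rfl hi | skip
    · exact (dαβ j j' hj).ne_of_mem (mem _ s) (mem _ t)
    · exact (dαγ j j' hj).ne_of_mem (mem _ s) (mem _ t)
    · exact (dαβ j' j hj.symm).symm.ne_of_mem (mem _ s) (mem _ t)
    · exact (dβγ j j' hj).ne_of_mem (mem _ s) (mem _ t)
    · exact (dαγ j' j hj.symm).symm.ne_of_mem (mem _ s) (mem _ t)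
    · exact (dβγ j' j hj.symm).symm.ne_of_mem (mem _ s) (mem _ t)

end SimpleGraph

/-! ### Walks in the Petersen graph

The Petersen graph has the two-element subsets of `Fin 5` as vertices, adjacent when disjoint. -/

/-- The neighbors of `a` in the Petersen graph. -/
def petersenNeighbors (a : Finset (Fin 5)) : Finset (Finset (Fin 5)) :=
  aᶜ.powersetCard 2

theorem mem_petersenNeighbors {a b : Finset (Fin 5)} :
    b ∈ petersenNeighbors a ↔ Disjoint a b ∧ b.card = 2 := by
  rw [petersenNeighbors, Finset.mem_powersetCard, Finset.subset_compl_iff_disjoint_left]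

theorem card_petersenNeighbors {a : Finset (Fin 5)} (ha : a.card = 2) :
    (petersenNeighbors a).card = 3 := by
  rw [petersenNeighbors, Finset.card_powersetCard, Finset.card_compl, ha]
  rfl

/-- This supplies a free color at a vertex with at most two neighbors already colored. -/
theorem exists_disjoint_notMem {a : Finset (Fin 5)} (ha : a.card = 2)
    {s : Finset (Finset (Fin 5))} (hs : s.card ≤ 2) :
    ∃ b, b.card = 2 ∧ Disjoint a b ∧ b ∉ s := by
  obtain ⟨b, hb, hbs⟩ := Finset.exists_mem_notMem_of_card_lt_card
    (s := s) (t := petersenNeighbors a) (by rw [card_petersenNeighbors ha]; omega)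
  rw [mem_petersenNeighbors] at hb
  exact ⟨b, hb.2, hb.1, hbs⟩

theorem exists_perm_edge {a b : Finset (Fin 5)} (ha : a.card = 2) (hb : b.card = 2)
    (hab : Disjoint a b) :
    ∃ σ : Equiv.Perm (Fin 5), ({2, 3} : Finset (Fin 5)).map σ.toEmbedding = a ∧
      ({0, 1} : Finset (Fin 5)).map σ.toEmbedding = b := by
  obtain ⟨x, y, hxy, rfl⟩ := Finset.card_eq_two.1 ha
  obtain ⟨z, w, hzw, rfl⟩ := Finset.card_eq_two.1 hb
  obtain ⟨e, he⟩ : ∃ e : Fin 5, e ∉ ({x, y} ∪ {z, w} : Finset (Fin 5)) := by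
    by_contra! h
    have := Finset.card_le_card (fun e _ ↦ h e : (Finset.univ : Finset (Fin 5)) ⊆ _)
    rw [Finset.card_union_of_disjoint hab, ha, hb] at this
    simp at this
  simp only [Finset.disjoint_left, Finset.mem_insert, Finset.mem_singleton, Finset.mem_union,
    not_or] at hab he
  have h1 := hab (Or.inl rfl)
  have h2 := hab (Or.inr rfl)
  have hinj : Function.Injective ![z, w, x, y, e] := by
    intro i j h
    fin_cases i <;> fin_cases j <;> simp at h ⊢ <;> grind
  refine ⟨Equiv.ofBijective _ (Finite.injective_iff_bijective.1 hinj), ?_, ?_⟩ <;>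
    ext t <;> simp [eq_comm]

/-- The Petersen graph is 3-arc-transitive. -/
theorem exists_perm_three_arc {s a b t : Finset (Fin 5)} (hs : s.card = 2) (ha : a.card = 2)
    (hb : b.card = 2) (ht : t.card = 2) (hsa : Disjoint s a) (hab : Disjoint a b)
    (hbt : Disjoint b t) (hsb : s ≠ b) (hat : a ≠ t) :
    ∃ σ : Equiv.Perm (Fin 5), ({0, 4} : Finset (Fin 5)).map σ.toEmbedding = s ∧
      ({2, 3} : Finset (Fin 5)).map σ.toEmbedding = a ∧
      ({0, 1} : Finset (Fin 5)).map σ.toEmbedding = b ∧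
      ({2, 4} : Finset (Fin 5)).map σ.toEmbedding = t := by
  obtain ⟨σ, rfl, rfl⟩ := exists_perm_edge ha hb hab
  obtain ⟨s, rfl⟩ : ∃ s', s'.map σ.toEmbedding = s := ⟨s.map σ.symm.toEmbedding, by
    simp [Finset.map_map]⟩
  obtain ⟨t, rfl⟩ : ∃ t', t'.map σ.toEmbedding = t := ⟨t.map σ.symm.toEmbedding, by
    simp [Finset.map_map]⟩
  rw [Finset.disjoint_map] at hsa hbt
  rw [Finset.card_map] at hs ht
  have h1 : ∀ s : Finset (Fin 5), s.card = 2 → Disjoint s {2, 3} → s ≠ {0, 1} →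
      s = {0, 4} ∨ s = {1, 4} := by decide
  have h2 : ∀ t : Finset (Fin 5), t.card = 2 → Disjoint {0, 1} t → {2, 3} ≠ t →
      t = {2, 4} ∨ t = {3, 4} := by decide
  have hs' := h1 s hs hsa (by rintro rfl; exact hsb rfl)
  have ht' := h2 t ht hbt (by rintro rfl; exact hat rfl)
  -- With the middle arc in standard position, two choices remain at each end, and the swaps of 0, 1
  -- and of 2, 3 exchange them independently while fixing the middle arc.
  have key (τ : Equiv.Perm (Fin 5)) (h : ({0, 4} : Finset (Fin 5)).map τ.toEmbedding = s ∧
      ({2, 3} : Finset (Fin 5)).map τ.toEmbedding = {2, 3} ∧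
      ({0, 1} : Finset (Fin 5)).map τ.toEmbedding = {0, 1} ∧
      ({2, 4} : Finset (Fin 5)).map τ.toEmbedding = t) :
      ∃ ρ : Equiv.Perm (Fin 5), ({0, 4} : Finset (Fin 5)).map ρ.toEmbedding = s.map σ.toEmbedding ∧
      ({2, 3} : Finset (Fin 5)).map ρ.toEmbedding = ({2, 3} : Finset (Fin 5)).map σ.toEmbedding ∧
      ({0, 1} : Finset (Fin 5)).map ρ.toEmbedding = ({0, 1} : Finset (Fin 5)).map σ.toEmbedding ∧
      ({2, 4} : Finset (Fin 5)).map ρ.toEmbedding = t.map σ.toEmbedding := by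
    have e (A : Finset (Fin 5)) : A.map (τ.trans σ).toEmbedding =
        (A.map τ.toEmbedding).map σ.toEmbedding := by rw [Finset.map_map]; rfl
    exact ⟨τ.trans σ, by rw [e, h.1], by rw [e, h.2.1], by rw [e, h.2.2.1], by rw [e, h.2.2.2]⟩
  rcases hs' with rfl | rfl <;> rcases ht' with rfl | rfl
  · exact key 1 (by decide)
  · exact key (Equiv.swap 2 3) (by decide)
  · exact key (Equiv.swap 0 1) (by decide)
  · exact key (Equiv.swap 0 1 * Equiv.swap 2 3) (by decide)

/-- The Petersen graph is 3-arc-transitive. -/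
theorem exists_perm_map_three_arc {s a b t s' a' b' t' : Finset (Fin 5)}
    (hs : s.card = 2) (ha : a.card = 2) (hb : b.card = 2) (ht : t.card = 2) (hsa : Disjoint s a)
    (hab : Disjoint a b) (hbt : Disjoint b t) (hsb : s ≠ b) (hat : a ≠ t)
    (hs' : s'.card = 2) (ha' : a'.card = 2) (hb' : b'.card = 2) (ht' : t'.card = 2)
    (hsa' : Disjoint s' a') (hab' : Disjoint a' b') (hbt' : Disjoint b' t') (hsb' : s' ≠ b')
    (hat' : a' ≠ t') :
    ∃ σ : Equiv.Perm (Fin 5), s.map σ.toEmbedding = s' ∧ a.map σ.toEmbedding = a' ∧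
      b.map σ.toEmbedding = b' ∧ t.map σ.toEmbedding = t' := by
  obtain ⟨σ, rfl, rfl, rfl, rfl⟩ := exists_perm_three_arc hs ha hb ht hsa hab hbt hsb hat
  obtain ⟨τ, rfl, rfl, rfl, rfl⟩ :=
    exists_perm_three_arc hs' ha' hb' ht' hsa' hab' hbt' hsb' hat'
  have e (A : Finset (Fin 5)) : (A.map σ.toEmbedding).map (σ.symm.trans τ).toEmbedding =
      A.map τ.toEmbedding := by
    rw [Finset.map_map]
    congr 1
    ext x
    simp
  exact ⟨σ.symm.trans τ, e _, e _, e _, e _⟩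

theorem exists_perm_map_edge {a b a' b' : Finset (Fin 5)} (ha : a.card = 2) (hb : b.card = 2)
    (hab : Disjoint a b) (ha' : a'.card = 2) (hb' : b'.card = 2) (hab' : Disjoint a' b') :
    ∃ σ : Equiv.Perm (Fin 5), a.map σ.toEmbedding = a' ∧ b.map σ.toEmbedding = b' := by
  obtain ⟨σ, rfl, rfl⟩ := exists_perm_edge ha hb hab
  obtain ⟨τ, rfl, rfl⟩ := exists_perm_edge ha' hb' hab'
  have e (A : Finset (Fin 5)) : (A.map σ.toEmbedding).map (σ.symm.trans τ).toEmbedding =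
      A.map τ.toEmbedding := by
    rw [Finset.map_map]
    congr 1
    ext x
    simp
  exact ⟨σ.symm.trans τ, e _, e _⟩

/-- `g 0, g 1, …, g n` is a closed walk of length `n` in the Petersen graph that starts with the
arc `{0, 1}, {2, 3}` and never backtracks, not even where it closes up. -/
def IsPetersenTour (n : ℕ) (g : ℕ → Finset (Fin 5)) : Prop :=
  g 0 = {0, 1} ∧ g 1 = {2, 3} ∧ g n = {0, 1} ∧ g (n + 1) = {2, 3} ∧
    ∀ i < n, (g i).card = 2 ∧ Disjoint (g i) (g (i + 1)) ∧ g i ≠ g (i + 2)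

/-- All tours begin and close up along the same arc, so there is no backtracking at the junction. -/
theorem IsPetersenTour.append {m n : ℕ} {g h : ℕ → Finset (Fin 5)} (hg : IsPetersenTour m g)
    (hh : IsPetersenTour n h) (hm : 1 ≤ m) :
    IsPetersenTour (m + n) (fun i ↦ if i ≤ m then g i else h (i - m)) := by
  obtain ⟨g0, g1, gm, gm1, hg⟩ := hg
  obtain ⟨h0, h1, hn, hn1, hh⟩ := hh
  have eg (i) (hi : i ≤ m + 1) : (if i ≤ m then g i else h (i - m)) = g i := by
    split_ifs with him
    · rfl
    · obtain rfl : i = m + 1 := by omega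
      simp [gm1, h1]
  have eh (i) : (if i + m ≤ m then g (i + m) else h (i + m - m)) = h i := by
    split_ifs with him
    · obtain rfl : i = 0 := by omega
      simp [gm, h0]
    · simp
  refine ⟨by simp [g0], by simp [hm, g1], ?_, ?_, fun i hi ↦ ?_⟩
  · rw [add_comm]; exact (eh n).trans hn
  · rw [show m + n + 1 = n + 1 + m by omega]; exact (eh (n + 1)).trans hn1
  · by_cases him : i < m
    · simp only [eg i (by omega), eg (i + 1) (by omega), eg (i + 2) (by omega)]
      exact hg i him
    · obtain ⟨j, rfl⟩ : ∃ j, i = j + m := ⟨i - m, by omega⟩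
      have := hh j (by omega)
      simp only [show j + m + 1 = j + 1 + m by omega, show j + m + 2 = j + 2 + m by omega, eh]
      exact this

theorem exists_isPetersenTour (n : ℕ) (h5 : 5 ≤ n) (h7 : n ≠ 7) : ∃ g, IsPetersenTour n g := by
  have t5 : IsPetersenTour 5 fun i ↦
      [{0, 1}, {2, 3}, {0, 4}, {1, 2}, {3, 4}, {0, 1}, {2, 3}].getD i ∅ := by
    unfold IsPetersenTour; decide
  have t6 : IsPetersenTour 6 fun i ↦
      [{0, 1}, {2, 3}, {0, 4}, {1, 2}, {0, 3}, {2, 4}, {0, 1}, {2, 3}].getD i ∅ := by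
    unfold IsPetersenTour; decide
  have t8 : IsPetersenTour 8 fun i ↦
      [{0, 1}, {2, 3}, {0, 4}, {1, 2}, {0, 3}, {1, 4}, {0, 2}, {3, 4}, {0, 1}, {2, 3}].getD i
        ∅ := by
    unfold IsPetersenTour; decide
  have t9 : IsPetersenTour 9 fun i ↦
      [{0, 1}, {2, 3}, {0, 4}, {1, 2}, {0, 3}, {1, 4}, {0, 2}, {1, 3}, {2, 4}, {0, 1},
        {2, 3}].getD i ∅ := by
    unfold IsPetersenTour; decide
  induction n using Nat.strong_induction_on with
  | _ n ih =>
    by_cases h : n < 10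
    · interval_cases n
      exacts [⟨_, t5⟩, ⟨_, t6⟩, absurd rfl h7, ⟨_, t8⟩, ⟨_, t9⟩]
    -- Removing a tour of length 5 would leave the impossible length 7, hence `6 + 6`.
    by_cases h12 : n = 12
    · subst h12
      exact ⟨_, t6.append t6 (by omega)⟩
    · obtain ⟨g, hg⟩ := ih (n - 5) (by omega) (by omega) (by omega)
      obtain ⟨m, rfl⟩ : ∃ m, n = 5 + m := ⟨n - 5, by omega⟩
      rw [Nat.add_sub_cancel_left] at hg
      exact ⟨_, t5.append hg (by omega)⟩

/-! ### Locally injective maps to the Petersen graph -/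

namespace SimpleGraph

variable {V : Type*} {G H : SimpleGraph V}

/-- A locally injective homomorphism from `G` to the Petersen graph. -/
structure IsPetersenColoring (G : SimpleGraph V) (f : V → Finset (Fin 5)) : Prop where
  card_eq : ∀ v, (f v).card = 2
  disjoint : ∀ {u v}, G.Adj u v → Disjoint (f u) (f v)
  ne : ∀ {u v w}, G.Adj u v → G.Adj u w → v ≠ w → f v ≠ f w

theorem IsToneColoring.isPetersenColoring {f : V → Finset (Fin 5)} (hf : G.IsToneColoring 2 5 f) :
    G.IsPetersenColoring f where
  card_eq := hf.1
  disjoint {u v} h := by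
    have := hf.2 u v h.ne
    rw [edist_eq_one_iff_adj.2 h, ← Nat.cast_one, Nat.cast_lt, Nat.lt_one_iff,
      Finset.card_eq_zero] at this
    exact Finset.disjoint_iff_inter_eq_empty.2 this
  ne {u v w} hv hw hvw e := by
    have := (hf.2 v w hvw).trans_le (Walk.edist_le (.cons hv.symm (.cons hw .nil)))
    rw [e, Finset.inter_self, hf.1] at this
    simp at this

/-- Only distances 1 and 2 impose anything, since two color sets share at most two colors. At
distance 2 the sets must differ, which is injectivity on the neighborhood of the middle vertex. -/
theorem IsPetersenColoring.isToneColoring {f : V → Finset (Fin 5)} (hf : G.IsPetersenColoring f) :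
    G.IsToneColoring 2 5 f := by
  refine ⟨hf.card_eq, fun u v huv ↦ ?_⟩
  by_contra! h
  have hle : (f u ∩ f v).card ≤ 2 :=
    (Finset.card_le_card Finset.inter_subset_left).trans (hf.card_eq u).le
  obtain ⟨p, hp⟩ := G.exists_walk_of_edist_ne_top (ne_top_of_le_ne_top (ENat.natCast_ne_top _) h)
  rw [← hp, Nat.cast_le] at h
  match p, hp, h with
  | .nil, _, _ => exact huv rfl
  | .cons h1 .nil, _, h =>
    rw [Finset.disjoint_iff_inter_eq_empty.1 (hf.disjoint h1)] at h
    simp at h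
  | .cons h1 (.cons h2 .nil), _, h =>
    have h2' : (f u ∩ f v).card = 2 := le_antisymm hle (by simpa using h)
    have hu := Finset.eq_of_subset_of_card_le (Finset.inter_subset_left : f u ∩ f v ⊆ f u)
      (by rw [h2', hf.card_eq])
    have hv := Finset.eq_of_subset_of_card_le (Finset.inter_subset_right : f u ∩ f v ⊆ f v)
      (by rw [h2', hf.card_eq])
    exact hf.ne h1.symm h2 huv (hu.symm.trans hv)
  | .cons h1 (.cons h2 (.cons h3 p)), _, h =>
    simp only [Walk.length_cons] at h
    omega

theorem toneColorable_two_five_iff :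
    G.ToneColorable 2 5 ↔ ∃ f, G.IsPetersenColoring f :=
  ⟨fun ⟨f, hf⟩ ↦ ⟨f, hf.isPetersenColoring⟩, fun ⟨f, hf⟩ ↦ ⟨f, hf.isToneColoring⟩⟩

theorem IsPetersenColoring.comp {W : Type*} {K : SimpleGraph W} {f : V → Finset (Fin 5)}
    (hf : G.IsPetersenColoring f) (φ : Copy K G) : K.IsPetersenColoring (f ∘ φ) where
  card_eq _ := hf.card_eq _
  disjoint h := hf.disjoint (φ.toHom.map_adj h)
  ne h h' hne := hf.ne (φ.toHom.map_adj h) (φ.toHom.map_adj h') (φ.injective.ne hne)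

theorem IsPetersenColoring.mem_petersenNeighbors {f : V → Finset (Fin 5)}
    (hf : G.IsPetersenColoring f) {u v : V} (h : G.Adj u v) : f v ∈ petersenNeighbors (f u) :=
  _root_.mem_petersenNeighbors.2 ⟨hf.disjoint h, hf.card_eq v⟩

theorem not_isPetersenColoring_cycleGraph_three (f : Fin 3 → Finset (Fin 5)) :
    ¬ (cycleGraph 3).IsPetersenColoring f := by
  intro hf
  have key : ∀ a ∈ (Finset.univ : Finset (Fin 5)).powersetCard 2, ∀ b ∈ petersenNeighbors a,
      ∀ c ∈ petersenNeighbors b, a ∉ petersenNeighbors c := by decide +kernel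
  have adj : ∀ i : Fin 3, (cycleGraph 3).Adj i (i + 1) := by decide
  exact key (f 0) (by simp [hf.card_eq]) (f 1) (hf.mem_petersenNeighbors (adj 0)) (f 2)
    (hf.mem_petersenNeighbors (adj 1)) (hf.mem_petersenNeighbors (adj 2))

theorem not_isPetersenColoring_cycleGraph_four (f : Fin 4 → Finset (Fin 5)) :
    ¬ (cycleGraph 4).IsPetersenColoring f := by
  intro hf
  have key : ∀ a ∈ (Finset.univ : Finset (Fin 5)).powersetCard 2, ∀ b ∈ petersenNeighbors a,
      ∀ c ∈ (petersenNeighbors b).erase a, ∀ d ∈ (petersenNeighbors c).erase b,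
      a ∉ petersenNeighbors d := by decide +kernel
  have adj : ∀ i : Fin 4, (cycleGraph 4).Adj i (i + 1) := by decide
  have ne (i : Fin 4) (h : i + 1 + 1 ≠ i) : f (i + 1 + 1) ≠ f i :=
    hf.ne (adj (i + 1)) (adj i).symm h
  exact key (f 0) (by simp [hf.card_eq]) (f 1) (hf.mem_petersenNeighbors (adj 0)) (f 2)
    (Finset.mem_erase.2 ⟨ne 0 (by decide), hf.mem_petersenNeighbors (adj 1)⟩) (f 3)
    (Finset.mem_erase.2 ⟨ne 1 (by decide), hf.mem_petersenNeighbors (adj 2)⟩)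
    (hf.mem_petersenNeighbors (adj 3))

theorem not_isPetersenColoring_cycleGraph_seven (f : Fin 7 → Finset (Fin 5)) :
    ¬ (cycleGraph 7).IsPetersenColoring f := by
  intro hf
  -- The last two alternatives are the backtracks where the walk closes up; without excluding them,
  -- a 5-cycle with a pendant edge traversed back and forth has length 7.
  have key : ∀ a ∈ (Finset.univ : Finset (Fin 5)).powersetCard 2, ∀ b ∈ petersenNeighbors a,
      ∀ c ∈ (petersenNeighbors b).erase a, ∀ d ∈ (petersenNeighbors c).erase b,
      ∀ e ∈ (petersenNeighbors d).erase c, ∀ g ∈ (petersenNeighbors e).erase d,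
      ∀ h ∈ (petersenNeighbors g).erase e, a ∉ petersenNeighbors h ∨ h = b ∨ g = a := by
    decide +kernel
  have adj : ∀ i : Fin 7, (cycleGraph 7).Adj i (i + 1) := by decide
  have ne (i : Fin 7) (h : i + 1 + 1 ≠ i) : f (i + 1 + 1) ≠ f i :=
    hf.ne (adj (i + 1)) (adj i).symm h
  have := key (f 0) (by simp [hf.card_eq]) (f 1) (hf.mem_petersenNeighbors (adj 0)) (f 2)
    (Finset.mem_erase.2 ⟨ne 0 (by decide), hf.mem_petersenNeighbors (adj 1)⟩) (f 3)
    (Finset.mem_erase.2 ⟨ne 1 (by decide), hf.mem_petersenNeighbors (adj 2)⟩) (f 4)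
    (Finset.mem_erase.2 ⟨ne 2 (by decide), hf.mem_petersenNeighbors (adj 3)⟩) (f 5)
    (Finset.mem_erase.2 ⟨ne 3 (by decide), hf.mem_petersenNeighbors (adj 4)⟩) (f 6)
    (Finset.mem_erase.2 ⟨ne 4 (by decide), hf.mem_petersenNeighbors (adj 5)⟩)
  rcases this with h | h | h
  · exact h (hf.mem_petersenNeighbors (adj 6))
  · exact ne 6 (by decide) h.symm
  · exact ne 5 (by decide) h.symm

/-! ### Gluing colorings -/

/-- The subgraph of the edges with both endpoints in `S`, on the same vertex type. -/
def restrict (G : SimpleGraph V) (S : Set V) : SimpleGraph V where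
  Adj x y := G.Adj x y ∧ x ∈ S ∧ y ∈ S
  symm := ⟨fun _ _ h ↦ ⟨h.1.symm, h.2.2, h.2.1⟩⟩
  loopless := ⟨fun _ h ↦ h.1.ne rfl⟩

theorem restrict_lt {S : Set V} {x y : V} (h : G.Adj x y) (hx : x ∉ S) : G.restrict S < G := by
  refine lt_of_le_of_ne (fun _ _ h ↦ h.1) fun e ↦ ?_
  rw [← e] at h
  exact hx h.2.1

theorem IsPetersenColoring.map_perm {f : V → Finset (Fin 5)} (hf : G.IsPetersenColoring f)
    (σ : Equiv.Perm (Fin 5)) : G.IsPetersenColoring fun v ↦ (f v).map σ.toEmbedding where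
  card_eq v := by rw [Finset.card_map, hf.card_eq]
  disjoint h := (Finset.disjoint_map _).2 (hf.disjoint h)
  ne h h' hne e := hf.ne h h' hne (Finset.map_injective _ e)

open Classical in
/-- Colorings on the two sides of a partition into unions of components combine. -/
theorem IsPetersenColoring.piecewise_of_closed {S : Set V} {f g : V → Finset (Fin 5)}
    (hS : ∀ x ∈ S, ∀ y, G.Adj x y → y ∈ S) (hf : (G.restrict S).IsPetersenColoring f)
    (hg : (G.restrict Sᶜ).IsPetersenColoring g) : G.IsPetersenColoring (S.piecewise f g) := by
  have h1 {x y} (hx : x ∈ S) (h : G.Adj x y) : (G.restrict S).Adj x y := ⟨h, hx, hS x hx y h⟩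
  have h2 {x y} (hx : x ∉ S) (h : G.Adj x y) : (G.restrict Sᶜ).Adj x y :=
    ⟨h, hx, fun hy ↦ hx (hS y hy x h.symm)⟩
  refine ⟨fun v ↦ ?_, fun {u v} h ↦ ?_, fun {u v w} hv hw hvw ↦ ?_⟩
  · by_cases hv : v ∈ S
    · simp [hv, hf.card_eq]
    · simp [hv, hg.card_eq]
  · by_cases hu : u ∈ S
    · simpa [hu, (h1 hu h).2.2] using hf.disjoint (h1 hu h)
    · have := (h2 hu h).2.2
      rw [Set.mem_compl_iff] at this
      simpa [hu, this] using hg.disjoint (h2 hu h)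
  · by_cases hu : u ∈ S
    · simpa [(h1 hu hv).2.2, (h1 hu hw).2.2] using hf.ne (h1 hu hv) (h1 hu hw) hvw
    · have a := (h2 hu hv).2.2
      have b := (h2 hu hw).2.2
      rw [Set.mem_compl_iff] at a b
      simpa [a, b] using hg.ne (h2 hu hv) (h2 hu hw) hvw

open Classical in
/-- Colorings of the two sides of a chord `uv` combine. -/
theorem exists_isPetersenColoring_of_chord {S : Set V} {u v x₀ y₀ x₁ y₁ : V}
    {f g : V → Finset (Fin 5)} (huv : G.Adj u v) (hu : u ∉ S) (hv : v ∉ S)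
    (hS : ∀ x ∈ S, ∀ y, G.Adj x y → y ∈ S ∨ y = u ∨ y = v)
    (hf : (G.restrict Sᶜ).IsPetersenColoring f)
    (hg : (G.restrict (S ∪ {u, v})).IsPetersenColoring g)
    (hx₀ : x₀ ∈ S) (hux₀ : G.Adj u x₀) (hy₀ : y₀ ∉ S)
    (hNu : ∀ x, G.Adj u x → x = v ∨ x = x₀ ∨ x = y₀)
    (hx₁ : x₁ ∈ S) (hvx₁ : G.Adj v x₁) (hy₁ : y₁ ∉ S)
    (hNv : ∀ x, G.Adj v x → x = u ∨ x = x₁ ∨ x = y₁) :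
    ∃ f, G.IsPetersenColoring f := by
  have huvf : (G.restrict Sᶜ).Adj u v := ⟨huv, hu, hv⟩
  have huvg : (G.restrict (S ∪ {u, v})).Adj u v := ⟨huv, by simp, by simp⟩
  have hux₀g : (G.restrict (S ∪ {u, v})).Adj u x₀ := ⟨hux₀, by simp, Or.inl hx₀⟩
  have hvx₁g : (G.restrict (S ∪ {u, v})).Adj v x₁ := ⟨hvx₁, by simp, Or.inl hx₁⟩
  -- The colors `s` and `t` are those that `f` leaves free for `x₀` next to `u` and for `x₁` next to
  -- `v`. The 3-arc `x₀, u, v, x₁` as colored by `g` is then moved to `s, f u, f v, t`.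
  obtain ⟨s, hs, hus, hs'⟩ := exists_disjoint_notMem (hf.card_eq u) (s := {f v, f y₀})
    Finset.card_le_two
  obtain ⟨t, ht, hvt, ht'⟩ := exists_disjoint_notMem (hf.card_eq v) (s := {f u, f y₁})
    Finset.card_le_two
  simp only [Finset.mem_insert, Finset.mem_singleton, not_or] at hs' ht'
  obtain ⟨σ, h1, h2, h3, h4⟩ := exists_perm_map_three_arc (hg.card_eq x₀) (hg.card_eq u)
    (hg.card_eq v) (hg.card_eq x₁) (hg.disjoint hux₀g.symm) (hg.disjoint huvg)
    (hg.disjoint hvx₁g) (hg.ne hux₀g huvg (fun h ↦ hv (h ▸ hx₀)))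
    (hg.ne huvg.symm hvx₁g (fun h ↦ hu (h ▸ hx₁))) hs (hf.card_eq u) (hf.card_eq v) ht
    hus.symm (hf.disjoint huvf) hvt hs'.1 (Ne.symm ht'.1)
  have hg' := hg.map_perm σ
  set k : V → Finset (Fin 5) := fun v ↦ (g v).map σ.toEmbedding with hk
  have eA {x} (hx : x ∈ S ∪ {u, v}) : S.piecewise k f x = k x := by
    by_cases hxS : x ∈ S
    · simp [hxS]
    · rcases hx with hx | rfl | rfl
      · exact absurd hx hxS
      · simp [hxS, hk, h2]
      · simp [hxS, hk, h3]
  have eB {x} (hx : x ∉ S) : S.piecewise k f x = f x := by simp [hx]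
  have adjA {x y} (hx : x ∈ S) (h : G.Adj x y) : (G.restrict (S ∪ {u, v})).Adj x y := by
    refine ⟨h, Or.inl hx, ?_⟩
    rcases hS x hx y h with h | rfl | rfl <;> simp [*]
  have cross {m x y} (hm : m ∉ S) (hx : x ∈ S) (hy : y ∉ S) (hmx : G.Adj m x)
      (hmy : G.Adj m y) : k x ≠ f y := by
    rcases hS x hx m hmx.symm with h | rfl | rfl
    · exact absurd h hm
    · obtain rfl : x = x₀ := by
        rcases hNu x hmx with rfl | h | rfl
        exacts [absurd hx hv, h, absurd hx hy₀]
      rw [show k x = s from h1]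
      rcases hNu y hmy with rfl | rfl | rfl
      exacts [hs'.1, absurd hx₀ hy, hs'.2]
    · obtain rfl : x = x₁ := by
        rcases hNv x hmx with rfl | h | rfl
        exacts [absurd hx hu, h, absurd hx hy₁]
      rw [show k x = t from h4]
      rcases hNv y hmy with rfl | rfl | rfl
      exacts [ht'.1, absurd hx₁ hy, ht'.2]
  refine ⟨S.piecewise k f, fun x ↦ ?_, fun {x y} h ↦ ?_, fun {m x y} hx hy hxy ↦ ?_⟩
  · by_cases hx : x ∈ S
    · rw [eA (Or.inl hx), hg'.card_eq]
    · rw [eB hx, hf.card_eq]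
  · by_cases hx : x ∈ S
    · have := adjA hx h
      rw [eA this.2.1, eA this.2.2]
      exact hg'.disjoint this
    by_cases hy : y ∈ S
    · have := (adjA hy h.symm).symm
      rw [eA this.2.1, eA this.2.2]
      exact hg'.disjoint this
    · rw [eB hx, eB hy]
      exact hf.disjoint ⟨h, hx, hy⟩
  · by_cases hm : m ∈ S
    · have h1 := adjA hm hx
      have h2 := adjA hm hy
      rw [eA h1.2.2, eA h2.2.2]
      exact hg'.ne h1 h2 hxy
    by_cases hxS : x ∈ S <;> by_cases hyS : y ∈ S
    · rw [eA (Or.inl hxS), eA (Or.inl hyS)]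
      exact hg'.ne (adjA hxS hx.symm).symm (adjA hyS hy.symm).symm hxy
    · rw [eA (Or.inl hxS), eB hyS]
      exact cross hm hxS hyS hx hy
    · rw [eA (Or.inl hyS), eB hxS]
      exact (cross hm hyS hxS hy hx).symm
    · rw [eB hxS, eB hyS]
      exact hf.ne ⟨hx, hm, hxS⟩ ⟨hy, hm, hyS⟩ hxy

/-- A subcubic graph has a Petersen coloring if it has one after the deletion of a bridge. -/
theorem exists_isPetersenColoring_of_isBridge [Finite V] {u v : V} {f : V → Finset (Fin 5)}
    (hdeg : ∀ v, (G.neighborSet v).ncard ≤ 3) (huv : G.Adj u v) (hb : G.IsBridge s(u, v))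
    (hf : (G.deleteEdges {s(u, v)}).IsPetersenColoring f) : ∃ f, G.IsPetersenColoring f := by
  classical
  set G' := G.deleteEdges {s(u, v)} with hG'
  rw [isBridge_iff] at hb
  have adj' {x y} (h : G.Adj x y) : G'.Adj x y ∨ (x = u ∧ y = v) ∨ (x = v ∧ y = u) := by
    by_cases he : s(x, y) = s(u, v)
    · exact Or.inr (by simpa using he)
    · exact Or.inl (by simp [hG', h, he])
  have free (x y) (hxy : G.Adj x y) (hxy' : ¬ G'.Adj x y) :
      ∃ b, b.card = 2 ∧ Disjoint (f x) b ∧ ∀ z, G'.Adj x z → f z ≠ b := by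
    have hfin : (G'.neighborSet x).Finite := Set.toFinite _
    have hlt : (G'.neighborSet x).ncard < (G.neighborSet x).ncard :=
      Set.ncard_lt_ncard ⟨fun z hz ↦ G.deleteEdges_le _ hz, fun h ↦ hxy' (h hxy)⟩
        (Set.toFinite _)
    have hle : (hfin.toFinset.image f).card ≤ 2 := by
      refine Finset.card_image_le.trans ?_
      rw [← Set.ncard_eq_toFinset_card]
      have := hdeg x
      omega
    obtain ⟨b, hb, hd, hn⟩ := exists_disjoint_notMem (hf.card_eq x) hle
    exact ⟨b, hb, hd, fun z hz e ↦ hn (Finset.mem_image.2 ⟨z, by simpa using hz, e⟩)⟩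
  obtain ⟨b, hbc, hub, hb'⟩ := free u v huv (by simp [hG'])
  obtain ⟨d, hdc, hvd, hd'⟩ := free v u huv.symm (by simp [hG', Sym2.eq_swap])
  -- Recoloring the side of `v` by `σ` gives `v` the color `b` that is free at `u`, and turns the
  -- color `d` that is free at `v` into `f u`.
  obtain ⟨σ, h1, h2⟩ := exists_perm_map_edge (hf.card_eq v) hdc hvd hbc (hf.card_eq u) hub.symm
  have hk := hf.map_perm σ
  set k : V → Finset (Fin 5) := fun v ↦ (f v).map σ.toEmbedding with hkdef
  set S : Set V := {x | G'.Reachable v x} with hS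
  have hvS : v ∈ S := Reachable.refl v
  have huS : u ∉ S := fun h ↦ hb (Reachable.symm h)
  have hcl {x y} (h : G'.Adj x y) : x ∈ S ↔ y ∈ S :=
    ⟨fun hx ↦ Reachable.trans hx h.reachable, fun hx ↦ Reachable.trans hx h.symm.reachable⟩
  have hkd {z} (h : G'.Adj v z) : k z ≠ f u := by
    rw [← h2]
    exact fun e ↦ hd' z h (Finset.map_injective _ e)
  have base : G'.IsPetersenColoring (S.piecewise k f) := by
    refine IsPetersenColoring.piecewise_of_closed (fun x hx y h ↦ (hcl h).1 hx) ?_ ?_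
    · exact ⟨hk.card_eq, fun h ↦ hk.disjoint h.1, fun h h' ↦ hk.ne h.1 h'.1⟩
    · exact ⟨hf.card_eq, fun h ↦ hf.disjoint h.1, fun h h' ↦ hf.ne h.1 h'.1⟩
  have ev : S.piecewise k f v = b := by simp [hvS, hkdef, h1]
  have eu : S.piecewise k f u = f u := by simp [huS]
  have nu {z} (h : G'.Adj u z) : S.piecewise k f z ≠ b := by
    have : z ∉ S := fun hz ↦ huS ((hcl h).2 hz)
    simpa [this] using hb' z h
  have nv {z} (h : G'.Adj v z) : S.piecewise k f z ≠ f u := by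
    have : z ∈ S := (hcl h).1 hvS
    simpa [this] using hkd h
  refine ⟨S.piecewise k f, base.card_eq, fun {x y} h ↦ ?_, fun {m x y} hx hy hxy ↦ ?_⟩
  · rcases adj' h with h | ⟨rfl, rfl⟩ | ⟨rfl, rfl⟩
    · exact base.disjoint h
    · rwa [ev, eu]
    · rw [ev, eu]; exact hub.symm
  · rcases adj' hx with hx | ⟨rfl, rfl⟩ | ⟨rfl, rfl⟩
    · rcases adj' hy with hy | ⟨rfl, rfl⟩ | ⟨rfl, rfl⟩
      · exact base.ne hx hy hxy
      · rw [ev]; exact nu hx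
      · rw [eu]; exact nv hx
    · rcases adj' hy with hy | ⟨-, rfl⟩ | ⟨h, rfl⟩
      · rw [ev]; exact (nu hy).symm
      · exact absurd rfl hxy
      · exact absurd h huv.ne
    · rcases adj' hy with hy | ⟨h, rfl⟩ | ⟨-, rfl⟩
      · rw [eu]; exact (nv hy).symm
      · exact absurd h huv.ne'
      · exact absurd rfl hxy

/-! ### Coloring a chordless cycle -/

theorem Walk.exists_getVert_of_mem_edges {u v x y : V} {p : G.Walk u v} (h : s(x, y) ∈ p.edges) :
    ∃ i < p.length, s(p.getVert i, p.getVert (i + 1)) = s(x, y) := by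
  induction p with
  | nil => simp at h
  | cons hadj p ih =>
    rw [Walk.edges_cons, List.mem_cons] at h
    rcases h with h | h
    · exact ⟨0, by simp, by simp [h]⟩
    · obtain ⟨i, hi, e⟩ := ih h
      exact ⟨i + 1, by simp [hi], by simpa using e⟩

/-- The vertices of a chordless cycle can be colored. -/
theorem Walk.IsCycle.exists_isPetersenColoring {v : V} {c : G.Walk v v} (hc : c.IsCycle)
    (h5 : 5 ≤ c.length) (h7 : c.length ≠ 7)
    (hchord : ∀ x ∈ c.support, ∀ y ∈ c.support, G.Adj x y → s(x, y) ∈ c.edges) :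
    ∃ f, (G.restrict {x | x ∈ c.support}).IsPetersenColoring f := by
  classical
  obtain ⟨g, g0, g1, gn, gn1, hg⟩ := exists_isPetersenTour c.length h5 h7
  have hidx : ∀ x ∈ c.support, ∃ i < c.length, c.getVert i = x := by
    intro x hx
    obtain ⟨i, rfl, hi⟩ := Walk.mem_support_iff_exists_getVert.1 hx
    rcases hi.lt_or_eq with hi | rfl
    · exact ⟨i, hi, rfl⟩
    · exact ⟨0, by omega, by simp⟩
  choose! idx hidx hidx' using hidx
  have inj {i j} (hi : i < c.length) (hj : j < c.length) (h : c.getVert i = c.getVert j) :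
      i = j := hc.getVert_injOn' (by simp; omega) (by simp; omega) h
  -- Vertices off the cycle are isolated in the restricted graph, so any 2-subset serves there.
  set f : V → Finset (Fin 5) := fun x ↦ if x ∈ c.support then g (idx x) else {0, 1} with hfdef
  have hf {i} (hi : i ≤ c.length) : f (c.getVert i) = g i := by
    have hmem := c.getVert_mem_support i
    simp only [hfdef, hmem, if_true]
    have e := hidx' _ hmem
    rcases hi.lt_or_eq with hi | rfl
    · rw [inj (hidx _ hmem) hi e]
    · rw [gn, ← g0]
      congr 1
      exact inj (hidx _ hmem) (by omega) (by simp at e ⊢; exact e)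
  have hcol {i} (hi : i < c.length) : (g i).card = 2 ∧ Disjoint (g i) (g (i + 1)) :=
    ⟨(hg i hi).1, (hg i hi).2.1⟩
  have cross {i j} (hi : i < c.length) (hj : j < c.length)
      (h : c.getVert i = c.getVert (j + 1)) : f (c.getVert (i + 1)) ≠ f (c.getVert j) := by
    rw [hf hi, hf hj.le]
    rcases (show j + 1 ≤ c.length from hj).lt_or_eq with hj' | hj'
    · obtain rfl := inj hi hj' h
      exact (hg j hj).2.2.symm
    -- The common vertex is the base point; its two neighbors on the cycle are compared through `g
    -- (n + 1) = g 1`.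
    · obtain rfl : i = 0 := inj hi (by omega) (by rw [h, hj']; simp)
      have := (hg j hj).2.2
      rw [show j + 2 = c.length + 1 by omega, gn1, ← g1] at this
      exact this.symm
  refine ⟨f, fun x ↦ ?_, fun {x y} h ↦ ?_, fun {m x y} hx hy hxy ↦ ?_⟩
  · by_cases hx : x ∈ c.support
    · rw [← hidx' x hx, hf (hidx x hx).le]
      exact (hcol (hidx x hx)).1
    · simp [hfdef, hx]
  · obtain ⟨i, hi, e⟩ := Walk.exists_getVert_of_mem_edges (hchord x h.2.1 y h.2.2 h.1)
    rcases Sym2.eq_iff.1 e with ⟨rfl, rfl⟩ | ⟨rfl, rfl⟩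
    · rw [hf hi.le, hf hi]; exact (hcol hi).2
    · rw [hf hi.le, hf hi]; exact (hcol hi).2.symm
  · obtain ⟨i, hi, e⟩ := Walk.exists_getVert_of_mem_edges (hchord m hx.2.1 x hx.2.2 hx.1)
    obtain ⟨j, hj, e'⟩ := Walk.exists_getVert_of_mem_edges (hchord m hy.2.1 y hy.2.2 hy.1)
    rcases Sym2.eq_iff.1 e with ⟨hm, rfl⟩ | ⟨rfl, hm⟩ <;>
      rcases Sym2.eq_iff.1 e' with ⟨hm', rfl⟩ | ⟨rfl, hm'⟩
    · obtain rfl := inj hi hj (hm.trans hm'.symm)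
      exact absurd rfl hxy
    · exact cross hi hj (hm.trans hm'.symm)
    · exact (cross hj hi (hm'.trans hm.symm)).symm
    · have := hc.getVert_injOn (by simp; omega) (by simp; omega) (hm.trans hm'.symm)
      obtain rfl : i = j := by omega
      exact absurd rfl hxy

end SimpleGraph

/-! ### Cycles and chords in admissible graphs -/

namespace SimpleGraph

variable {V : Type*} {G H : SimpleGraph V}

/-- The graphs to which the coloring argument applies: subcubic, without cycles of the lengths
3, 4, 7, and without subdivisions of `K₂,₃` in a weak sense. -/
structure IsAdmissible (G : SimpleGraph V) : Prop where
  ncard_le : ∀ v, (G.neighborSet v).ncard ≤ 3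
  length_ne : ∀ {v} (c : G.Walk v v), c.IsCycle → c.length ≠ 3 ∧ c.length ≠ 4 ∧ c.length ≠ 7
  not_disjoint : ∀ {a b : V} {p : Fin 3 → V} (A : ∀ j, G.Walk a (p j)) (B : ∀ j, G.Walk b (p j)),
    ¬ ∀ i j, i ≠ j → (A i).support.Disjoint (B j).support

namespace IsAdmissible

theorem mono [Finite V] (hG : G.IsAdmissible) (h : H ≤ G) : H.IsAdmissible where
  ncard_le v := (Set.ncard_le_ncard (fun _ hx ↦ h hx) (Set.toFinite _)).trans (hG.ncard_le v)
  length_ne c hc := by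
    have := hG.length_ne (c.mapLe h) ((Walk.isCycle_mapLe h).2 hc)
    simpa using this
  not_disjoint A B hAB := hG.not_disjoint (fun j ↦ (A j).mapLe h) (fun j ↦ (B j).mapLe h)
    fun i j hij ↦ by simpa using hAB i j hij

theorem eq_of_adj [Finite V] (hG : G.IsAdmissible) {u a b c x : V} (ha : G.Adj u a)
    (hb : G.Adj u b) (hc : G.Adj u c) (hab : a ≠ b) (hac : a ≠ c) (hbc : b ≠ c)
    (hx : G.Adj u x) : x = a ∨ x = b ∨ x = c := by
  have hsub : ({a, b, c} : Set V) ⊆ G.neighborSet u := by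
    rintro y (rfl | rfl | rfl) <;> assumption
  have hcard : ({a, b, c} : Set V).ncard = 3 := by
    rw [Set.ncard_eq_three]
    exact ⟨a, b, c, hab, hac, hbc, rfl⟩
  have := Set.eq_of_subset_of_ncard_le hsub (by rw [hcard]; exact hG.ncard_le u) (Set.toFinite _)
  have hx' : x ∈ ({a, b, c} : Set V) := this ▸ hx
  simpa using hx'

end IsAdmissible

theorem Walk.IsPath.snd_ne_end {u v : V} {p : G.Walk u v} (hp : p.IsPath) (h : 2 ≤ p.length) :
    p.snd ≠ v := fun e ↦ by
  have := (hp.getVert_eq_end_iff (i := 1) (by omega)).1 e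
  omega

theorem Walk.two_le_length {u v : V} (p : G.Walk u v) (huv : u ≠ v) (h : s(u, v) ∉ p.edges) :
    2 ≤ p.length := by
  match p, huv, h with
  | .nil, huv, _ => exact absurd rfl huv
  | .cons _ .nil, _, h => simp at h
  | .cons _ (.cons _ _), _, _ => simp

/-- The two paths into which a cycle is split meet only in their endpoints. -/
theorem Walk.IsCycle.eq_or_eq_of_mem_append {u v x : V} {p : G.Walk u v} {q : G.Walk v u}
    (hc : (p.append q).IsCycle) (hp : x ∈ p.support) (hq : x ∈ q.support) : x = u ∨ x = v := by
  have := hc.support_nodup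
  rw [Walk.tail_support_append, List.nodup_append'] at this
  rw [Walk.mem_support_iff] at hp hq
  by_contra! h
  exact this.2.2 (hp.resolve_left h.1) (hq.resolve_left h.2)

namespace IsAdmissible

/-- There are no three internally disjoint paths of length at least two between two vertices. -/
theorem false_of_three_paths (hG : G.IsAdmissible) {a b : V} (P : Fin 3 → G.Walk a b)
    (hP : ∀ i, (P i).IsPath) (hlen : ∀ i, 2 ≤ (P i).length)
    (hdisj : ∀ i j, i ≠ j → ∀ x, x ∈ (P i).support → x ∈ (P j).support → x = a ∨ x = b) :
    False := by
  have hnil (i) : ¬ (P i).Nil := by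
    rw [Walk.not_nil_iff_lt_length]; have := hlen i; omega
  -- The middle vertex of each path is its second vertex, which differs from `b` because the length
  -- is at least two.
  refine hG.not_disjoint (p := fun j ↦ (P j).snd)
    (fun j ↦ .cons ((P j).adj_snd (hnil j)) .nil) (fun j ↦ (P j).tail.reverse) ?_
  intro i j hij x hx hx'
  have hpath := (hP j).support_nodup
  rw [← Walk.cons_tail_support, List.nodup_cons, ← Walk.support_tail_of_not_nil _ (hnil j)]
    at hpath
  have hx'' : x ∈ (P j).tail.support := by
    rwa [Walk.support_reverse, List.mem_reverse] at hx'
  have hxs : x = a ∨ x = (P i).snd := by simpa using hx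
  rcases hxs with rfl | rfl
  · exact hpath.1 hx''
  · rw [Walk.support_tail_of_not_nil _ (hnil j)] at hx''
    rcases hdisj i j hij _ ((P i).getVert_mem_support 1) (List.mem_of_mem_tail hx'') with h | h
    · exact ((P i).adj_snd (hnil i)).ne h.symm
    · exact (hP i).snd_ne_end (hlen i) h

/-- In a bridgeless admissible graph, a longest cycle contains all neighbors of its vertices. -/
theorem mem_support_of_adj_start [Finite V] (hG : G.IsAdmissible)
    (hbr : ∀ u v, G.Adj u v → ¬ G.IsBridge s(u, v)) {u w : V} {c : G.Walk u u} (hc : c.IsCycle)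
    (hmax : ∀ (w : V) (c' : G.Walk w w), c'.IsCycle → c'.length ≤ c.length) (huw : G.Adj u w) :
    w ∈ c.support := by
  classical
  by_contra hw
  have hreach := hbr u w huw
  rw [isBridge_iff, not_not] at hreach
  obtain ⟨q⟩ := hreach.symm
  obtain ⟨v, hvs, hv, hfirst⟩ := q.exists_mem_support_forall_mem_support_imp_eq c.support.toFinset
    ⟨u, by simp⟩
  simp only [List.mem_toFinset] at hvs hfirst
  have hle : G.deleteEdges {s(u, w)} ≤ G := G.deleteEdges_le _
  set r₀ := (q.takeUntil v hv).bypass with hr₀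
  have hr₀p : r₀.IsPath := Walk.bypass_isPath _
  have hr₀c {x} (hx : x ∈ r₀.support) (hxc : x ∈ c.support) : x = v :=
    hfirst x hxc (Walk.support_bypass_subset_support _ hx)
  have hwv : w ≠ v := fun h ↦ hw (h ▸ hvs)
  -- If the path returned to `u` itself, its last edge would give `u` a fourth neighbor, besides `w`
  -- and the two on the cycle.
  have hvu : v ≠ u := by
    intro hvu
    have hn : ¬ r₀.Nil := Walk.not_nil_of_ne hwv
    have hadj := r₀.adj_penultimate hn
    have hy : r₀.penultimate ∉ c.support := fun h ↦
      hadj.ne (hr₀c (r₀.getVert_mem_support _) h)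
    have hyw : r₀.penultimate ≠ w := by
      intro e
      rw [e, hvu] at hadj
      simp [Sym2.eq_swap] at hadj
    have hcs := c.adj_snd hc.not_nil
    have hcp := (c.adj_penultimate hc.not_nil).symm
    have hsm : c.snd ∈ c.support := c.getVert_mem_support _
    have hpm : c.penultimate ∈ c.support := c.getVert_mem_support _
    have hadj' : G.Adj u r₀.penultimate := by
      have := (hle hadj).symm
      exact hvu ▸ this
    rcases hG.eq_of_adj hcs hcp huw hc.snd_ne_penultimate (fun h ↦ hw (h ▸ hsm))
      (fun h ↦ hw (h ▸ hpm)) hadj' with h | h | h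
    · exact hy (h ▸ hsm)
    · exact hy (h ▸ hpm)
    · exact hyw h
  set r : G.Walk w v := r₀.mapLe hle with hr
  have hrp : r.IsPath := (Walk.isPath_mapLe hle).2 hr₀p
  have hrc {x} (hx : x ∈ r.support) (hxc : x ∈ c.support) : x = v :=
    hr₀c (by simpa [hr] using hx) hxc
  obtain ⟨c₁, c₂, rfl⟩ := Walk.mem_support_iff_exists_append.1 hvs
  have hc₁ : c₁.IsPath := hc.isPath_of_append_left (Walk.not_nil_of_ne hvu)
  have hc₂ : c₂.IsPath := hc.isPath_of_append_right (Walk.not_nil_of_ne hvu.symm)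
  have hur : u ∉ r.support := fun h ↦ hvu (hrc h (Walk.start_mem_support _)).symm
  have hrl : 1 ≤ r.length := by
    have := Walk.not_nil_iff_lt_length.1 (Walk.not_nil_of_ne hwv : ¬ r.Nil)
    omega
  have hP : (Walk.cons huw r).IsPath := (Walk.cons_isPath_iff _ _).2 ⟨hrp, hur⟩
  -- Replacing either half of the cycle by the ear through `w` gives no longer cycle, so each half
  -- is at least as long as the ear, hence of length at least two.
  have long (d : G.Walk v u) (hd : d.IsPath)
      (hdc : ∀ x ∈ d.support, x ∈ (c₁.append c₂).support) :
      r.length + 1 + d.length ≤ (c₁.append c₂).length := by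
    have h := hmax _ ((Walk.cons huw r).append d) (hP.isCycle_append hd ?_ ?_)
    · simpa only [Walk.length_append, Walk.length_cons] using h
    · rw [List.disjoint_left]
      intro x hx hx'
      obtain rfl := hrc (by simpa using hx) (hdc x (List.mem_of_mem_tail hx'))
      have := hd.support_nodup
      rw [← Walk.cons_tail_support, List.nodup_cons] at this
      exact this.1 hx'
    · left; simp; omega
  have h1 := long c₂ hc₂ (by simp +contextual)
  have h2 := long c₁.reverse hc₁.reverse (by simp +contextual)
  simp only [Walk.length_append, Walk.length_reverse] at h1 h2
  have d12 {x} (h : x ∈ c₁.support) (h' : x ∈ c₂.support) : x = u ∨ x = v :=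
    hc.eq_or_eq_of_mem_append h h'
  have d3 {x} (h : x ∈ (Walk.cons huw r).support) (h' : x ∈ (c₁.append c₂).support) :
      x = u ∨ x = v := by
    rw [Walk.support_cons, List.mem_cons] at h
    exact h.imp_right fun h ↦ hrc h h'
  refine hG.false_of_three_paths ![c₁, c₂.reverse, .cons huw r] ?_ ?_ ?_
  · intro i
    fin_cases i
    exacts [hc₁, hc₂.reverse, hP]
  · intro i
    fin_cases i <;> simp <;> omega
  · intro i j hij x hx hx'
    fin_cases i <;> fin_cases j <;> first | exact absurd rfl hij | skip
    all_goals simp only [Fin.zero_eta, Fin.mk_one, Fin.reduceFinMk, Matrix.cons_val,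
      Walk.support_reverse, List.mem_reverse] at hx hx'
    · exact d12 hx hx'
    · exact d3 hx' (by simp [hx])
    · exact d12 hx' hx
    · exact d3 hx' (by simp [hx])
    · exact d3 hx (by simp [hx'])
    · exact d3 hx (by simp [hx'])

theorem mem_support_of_adj [Finite V] (hG : G.IsAdmissible)
    (hbr : ∀ u v, G.Adj u v → ¬ G.IsBridge s(u, v)) {v x y : V} {c : G.Walk v v} (hc : c.IsCycle)
    (hmax : ∀ (w : V) (c' : G.Walk w w), c'.IsCycle → c'.length ≤ c.length)
    (hx : x ∈ c.support) (hxy : G.Adj x y) : y ∈ c.support := by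
  classical
  have := hG.mem_support_of_adj_start hbr (c := c.rotate x hx) ((Walk.isCycle_rotate hx).2 hc)
    (by simpa using hmax) hxy
  simpa using this

/-- Two chords of a cycle in an admissible graph do not cross. -/
theorem not_adj_of_chord (hG : G.IsAdmissible) {u v x y : V} {c₁ : G.Walk u v} {c₂ : G.Walk v u}
    (hc : (c₁.append c₂).IsCycle) (huv : G.Adj u v) (hx : x ∈ c₁.support) (hxu : x ≠ u)
    (hxv : x ≠ v) (hy : y ∈ c₂.support) (hyu : y ≠ u) (hyv : y ≠ v) : ¬ G.Adj x y := by
  intro hxy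
  have hc₁ : c₁.IsPath := hc.isPath_of_append_left (Walk.not_nil_of_ne huv.ne')
  have hc₂ : c₂.IsPath := hc.isPath_of_append_right (Walk.not_nil_of_ne huv.ne)
  have d12 {x} (h : x ∈ c₁.support) (h' : x ∈ c₂.support) : x = u ∨ x = v :=
    hc.eq_or_eq_of_mem_append h h'
  obtain ⟨α, β, rfl⟩ := Walk.mem_support_iff_exists_append.1 hx
  obtain ⟨γ, δ, rfl⟩ := Walk.mem_support_iff_exists_append.1 hy
  have hα := hc₁.of_append_left
  have hβ := hc₁.of_append_right
  have hγ := hc₂.of_append_left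
  have hδ := hc₂.of_append_right
  have dαβ {z} (h : z ∈ α.support) (h' : z ∈ β.support) : z = x := by
    by_contra hz
    have := hc₁.support_nodup
    rw [Walk.support_append, List.nodup_append'] at this
    exact this.2.2 h (((Walk.mem_support_iff _).1 h').resolve_left hz)
  have dγδ {z} (h : z ∈ γ.support) (h' : z ∈ δ.support) : z = y := by
    by_contra hz
    have := hc₂.support_nodup
    rw [Walk.support_append, List.nodup_append'] at this
    exact this.2.2 h (((Walk.mem_support_iff _).1 h').resolve_left hz)
  have huβ : u ∉ β.support := fun h ↦ hxu (dαβ α.start_mem_support h).symm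
  have hvα : v ∉ α.support := fun h ↦ hxv (dαβ h β.end_mem_support).symm
  have huγ : u ∉ γ.support := fun h ↦ hyu (dγδ h δ.end_mem_support).symm
  have hvδ : v ∉ δ.support := fun h ↦ hyv (dγδ γ.start_mem_support h).symm
  have dx {z} (h : z ∈ α.support ∨ z ∈ β.support) (h' : z ∈ γ.support ∨ z ∈ δ.support) :
      z = u ∨ z = v := d12 (by simpa using h) (by simpa using h')
  have hxγ : x ∉ γ.support := fun h ↦ by
    rcases dx (.inl α.end_mem_support) (.inl h) with h | h
    exacts [hxu h, hxv h]
  have hxδ : x ∉ δ.support := fun h ↦ by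
    rcases dx (.inl α.end_mem_support) (.inr h) with h | h
    exacts [hxu h, hxv h]
  have pos {a b : V} (p : G.Walk a b) (h : a ≠ b) : 1 ≤ p.length := by
    have := Walk.not_nil_iff_lt_length.1 (Walk.not_nil_of_ne h : ¬ p.Nil)
    omega
  have lα := pos α hxu.symm
  have lβ := pos β hxv
  have lγ := pos γ hyv.symm
  have lδ := pos δ hyu
  -- The crossing chords and the four arcs form a subdivided `K₄`. If `α` had an inner vertex, there
  -- would be three disjoint paths of length at least two from `u` to `x`; likewise for `β` between
  -- `x` and `v`. So both are single edges, and `u, x, v` is a triangle.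
  have hα2 : α.length < 2 := by
    by_contra! hα2
    refine hG.false_of_three_paths ![α, δ.reverse.concat hxy.symm, .cons huv β.reverse] ?_ ?_ ?_
    · intro i
      fin_cases i
      exacts [hα, hδ.reverse.concat (by simpa using hxδ) _,
        hβ.reverse.cons (by simpa using huβ)]
    · intro i
      fin_cases i <;> simp <;> omega
    · intro i j hij z hz hz'
      fin_cases i <;> fin_cases j <;> first | exact absurd rfl hij | skip
      all_goals
        simp only [Fin.zero_eta, Fin.mk_one, Fin.reduceFinMk, Matrix.cons_val,
          Walk.support_reverse, Walk.support_concat, Walk.support_cons, List.mem_reverse,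
          List.mem_cons, List.mem_append, List.not_mem_nil, or_false] at hz hz'
        grind
  have hβ2 : β.length < 2 := by
    by_contra! hβ2
    refine hG.false_of_three_paths ![β, .cons hxy γ.reverse, α.reverse.concat huv] ?_ ?_ ?_
    · intro i
      fin_cases i
      exacts [hβ, hγ.reverse.cons (by simpa using hxγ),
        hα.reverse.concat (by simpa using hvα) _]
    · intro i
      fin_cases i <;> simp <;> omega
    · intro i j hij z hz hz'
      fin_cases i <;> fin_cases j <;> first | exact absurd rfl hij | skip
      all_goals
        simp only [Fin.zero_eta, Fin.mk_one, Fin.reduceFinMk, Matrix.cons_val,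
          Walk.support_reverse, Walk.support_concat, Walk.support_cons, List.mem_reverse,
          List.mem_cons, List.mem_append, List.not_mem_nil, or_false] at hz hz'
        grind
  have hlen : (α.append β).length = 2 := by rw [Walk.length_append]; omega
  refine (hG.length_ne ((α.append β).append (.cons huv.symm .nil)) ?_).1 (by
    rw [Walk.length_append, hlen]; rfl)
  refine hc₁.isCycle_append huv.symm.isPath_toWalk ?_ (.inl (by omega))
  rw [List.disjoint_left]
  intro z hz hz'
  obtain rfl : z = u := by simpa using hz'
  have := hc₁.support_nodup
  rw [← Walk.cons_tail_support, List.nodup_cons] at this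
  exact this.1 hz

theorem exists_longest_cycle [Finite V] (h : ∃ (v : V) (c : G.Walk v v), c.IsCycle) :
    ∃ (v : V) (c : G.Walk v v), c.IsCycle ∧
      ∀ (w : V) (c' : G.Walk w w), c'.IsCycle → c'.length ≤ c.length := by
  have := Fintype.ofFinite V
  set L : Set ℕ := {n | ∃ (v : V) (c : G.Walk v v), c.IsCycle ∧ c.length = n} with hL
  have hbdd : BddAbove L := by
    refine ⟨Fintype.card V + 1, ?_⟩
    rintro n ⟨v, c, hc, rfl⟩
    have := hc.isPath_tail.length_lt
    have := Walk.length_tail_add_one hc.not_nil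
    omega
  obtain ⟨v, c, hc⟩ := h
  obtain ⟨w, d, hd, hd'⟩ := Nat.sSup_mem (s := L) ⟨c.length, v, c, hc, rfl⟩ hbdd
  exact ⟨w, d, hd, fun w' c' hc' ↦ hd' ▸ le_csSup hbdd ⟨w', c', hc', rfl⟩⟩

/-- If a longest cycle has a chord, then colorings of smaller graphs combine. -/
theorem exists_isPetersenColoring_of_chord [Finite V] (hG : G.IsAdmissible)
    (ih : ∀ H < G, ∃ f, H.IsPetersenColoring f) {u v : V} {c : G.Walk u u} (hc : c.IsCycle)
    (hcl : ∀ x ∈ c.support, ∀ y, G.Adj x y → y ∈ c.support)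
    (huv : G.Adj u v) (hv : v ∈ c.support) (hchord : s(u, v) ∉ c.edges) :
    ∃ f, G.IsPetersenColoring f := by
  obtain ⟨c₁, c₂, rfl⟩ := Walk.mem_support_iff_exists_append.1 hv
  have hc₁ : c₁.IsPath := hc.isPath_of_append_left (Walk.not_nil_of_ne huv.ne')
  have hc₂ : c₂.IsPath := hc.isPath_of_append_right (Walk.not_nil_of_ne huv.ne)
  have d12 {x} (h : x ∈ c₁.support) (h' : x ∈ c₂.support) : x = u ∨ x = v :=
    hc.eq_or_eq_of_mem_append h h'
  rw [Walk.edges_append, List.mem_append, not_or] at hchord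
  have l₁ := c₁.two_le_length huv.ne hchord.1
  have l₂ := c₂.two_le_length huv.ne' (by rw [Sym2.eq_swap]; exact hchord.2)
  have n₁ : ¬ c₁.Nil := Walk.not_nil_of_ne huv.ne
  have n₂ : ¬ c₂.Nil := Walk.not_nil_of_ne huv.ne'
  have n₁' : ¬ c₁.reverse.Nil := Walk.not_nil_of_ne huv.ne'
  have n₂' : ¬ c₂.reverse.Nil := Walk.not_nil_of_ne huv.ne
  have ax₀ := c₁.adj_snd n₁
  have ax₁ := c₁.reverse.adj_snd n₁'
  have ay₀ := c₂.reverse.adj_snd n₂'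
  have ay₁ := c₂.adj_snd n₂
  set S : Set V := {x | x ∈ c₁.support ∧ x ≠ u ∧ x ≠ v} with hS
  have hx₀ : c₁.snd ∈ S := ⟨c₁.getVert_mem_support _, ax₀.ne', hc₁.snd_ne_end l₁⟩
  have hx₁ : c₁.reverse.snd ∈ S :=
    ⟨by simp, hc₁.reverse.snd_ne_end (by simpa using l₁),
      ax₁.ne'⟩
  have my₀ : c₂.reverse.snd ∈ c₂.support := by simp
  have hy₀v : c₂.reverse.snd ≠ v := hc₂.reverse.snd_ne_end (by simpa using l₂)
  have hy₁u : c₂.snd ≠ u := hc₂.snd_ne_end l₂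
  have hnS {x} (hx : x ∈ c₂.support) : x ∉ S := fun h ↦ by
    rcases d12 h.1 hx with e | e
    exacts [h.2.1 e, h.2.2 e]
  have hy₀ := hnS my₀
  have hy₁ := hnS (c₂.getVert_mem_support 1 : c₂.snd ∈ _)
  -- Since chords do not cross and the cycle fills its component, the interior of `c₁` is attached
  -- to the rest only at `u` and `v`.
  have hSadj : ∀ x ∈ S, ∀ y, G.Adj x y → y ∈ S ∨ y = u ∨ y = v := by
    rintro x ⟨hx, hxu, hxv⟩ y hxy
    by_contra! h
    have hy := hcl x (by simp [hx]) y hxy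
    rw [Walk.mem_support_append_iff] at hy
    rcases hy with hy | hy
    · exact h.1 ⟨hy, h.2⟩
    · exact hG.not_adj_of_chord hc huv hx hxu hxv hy h.2.1 h.2.2 hxy
  obtain ⟨f, hf⟩ := ih (G.restrict Sᶜ) (restrict_lt ax₀.symm (by simpa using hx₀))
  -- Both parts are proper subgraphs because each half of the cycle has an inner vertex: the first
  -- part loses the edge from `u` into `c₁`, the second the edge from `u` into `c₂`.
  obtain ⟨g, hg⟩ := ih (G.restrict (S ∪ {u, v})) (restrict_lt ay₀.symm (by
    rintro (h | h | h)
    exacts [hy₀ h, ay₀.ne' h, hy₀v h]))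
  refine SimpleGraph.exists_isPetersenColoring_of_chord huv (fun h ↦ h.2.1 rfl)
    (fun h ↦ h.2.2 rfl) hSadj hf hg hx₀ ax₀ hy₀ ?_ hx₁ ax₁ hy₁ ?_
  · exact fun x hx ↦ hG.eq_of_adj huv ax₀ ay₀ hx₀.2.2.symm hy₀v.symm
      (fun h ↦ hy₀ (h ▸ hx₀)) hx
  · exact fun x hx ↦ hG.eq_of_adj huv.symm ax₁ ay₁ hx₁.2.1.symm hy₁u.symm
      (fun h ↦ hy₁ (h ▸ hx₁)) hx

theorem exists_isPetersenColoring [Finite V] (hG : G.IsAdmissible) :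
    ∃ f, G.IsPetersenColoring f := by
  classical
  induction G using WellFoundedLT.induction with
  | _ G ih =>
    have ih' : ∀ H < G, ∃ f, H.IsPetersenColoring f := fun H hH ↦ ih H hH (hG.mono hH.le)
    by_cases hbr : ∃ u v, G.Adj u v ∧ G.IsBridge s(u, v)
    · obtain ⟨u, v, huv, hb⟩ := hbr
      obtain ⟨f, hf⟩ := ih' (G.deleteEdges {s(u, v)}) (lt_of_le_of_ne (G.deleteEdges_le _)
        fun e ↦ by
          have : (G.deleteEdges {s(u, v)}).Adj u v := e.symm ▸ huv
          simp at this)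
      exact exists_isPetersenColoring_of_isBridge hG.ncard_le huv hb hf
    push Not at hbr
    by_cases hE : ∃ u v, G.Adj u v
    · obtain ⟨u, v, huv⟩ := hE
      have hcyc : ∃ (v : V) (c : G.Walk v v), c.IsCycle := by
        have := hbr u v huv
        rw [isBridge_iff, not_not] at this
        obtain ⟨w, c, hc, -⟩ := adj_and_reachable_delete_edges_iff_exists_cycle.1 ⟨huv, this⟩
        exact ⟨w, c, hc⟩
      obtain ⟨w, c, hc, hmax⟩ := exists_longest_cycle hcyc
      have hcl {x y} (hx : x ∈ c.support) (hxy : G.Adj x y) : y ∈ c.support :=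
        hG.mem_support_of_adj hbr hc hmax hx hxy
      by_cases hchord : ∀ x ∈ c.support, ∀ y ∈ c.support, G.Adj x y → s(x, y) ∈ c.edges
      · have h3 := hc.three_le_length
        have hne := hG.length_ne c hc
        obtain ⟨f, hf⟩ := hc.exists_isPetersenColoring (by omega) hne.2.2 hchord
        obtain ⟨g, hg⟩ := ih' (G.restrict {x | x ∈ c.support}ᶜ)
          (restrict_lt (c.adj_snd hc.not_nil) (by simp))
        exact ⟨_, IsPetersenColoring.piecewise_of_closed (fun x hx y ↦ hcl hx) hf hg⟩
      · push Not at hchord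
        obtain ⟨x, hx, y, hy, hxy, he⟩ := hchord
        refine hG.exists_isPetersenColoring_of_chord ih' (c := c.rotate x hx)
          ((Walk.isCycle_rotate hx).2 hc) (fun a ha b hab ↦ ?_) hxy (by simpa using hy) ?_
        · simp only [Walk.mem_support_rotate_iff] at ha ⊢
          exact hcl ha hab
        · rwa [(c.rotate_edges x hx).mem_iff]
    · push Not at hE
      exact ⟨fun _ ↦ {0, 1}, fun _ ↦ rfl, fun h ↦ absurd h (hE _ _),
        fun h ↦ absurd h (hE _ _)⟩

end IsAdmissible

end SimpleGraph

/-! ### The characterization -/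

theorem theoremt1 {V : Type*} [Fintype V] (G : SimpleGraph V) [DecidableRel G.Adj]
    (hcubic : G.maxDegree ≤ 3) (houter : G.IsOuterplanar) :
    G.ToneColorable 2 5 ↔
      ¬ (SimpleGraph.cycleGraph 3).IsContained G ∧
      ¬ (SimpleGraph.cycleGraph 4).IsContained G ∧
      ¬ (SimpleGraph.cycleGraph 7).IsContained G := by
  rw [SimpleGraph.toneColorable_two_five_iff]
  constructor
  · rintro ⟨f, hf⟩
    exact ⟨fun ⟨φ⟩ ↦ SimpleGraph.not_isPetersenColoring_cycleGraph_three _ (hf.comp φ),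
      fun ⟨φ⟩ ↦ SimpleGraph.not_isPetersenColoring_cycleGraph_four _ (hf.comp φ),
      fun ⟨φ⟩ ↦ SimpleGraph.not_isPetersenColoring_cycleGraph_seven _ (hf.comp φ)⟩
  · rintro ⟨h3, h4, h7⟩
    rw [SimpleGraph.cycleGraph_isContained_iff (by norm_num)] at h3 h4 h7
    refine SimpleGraph.IsAdmissible.exists_isPetersenColoring ⟨fun v ↦ ?_, fun c hc ↦
      ⟨fun h ↦ h3 ⟨_, c, hc, h⟩, fun h ↦ h4 ⟨_, c, hc, h⟩, fun h ↦ h7 ⟨_, c, hc, h⟩⟩,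
      fun A B hAB ↦ houter.not_exists_walks A B hAB⟩
    rw [← SimpleGraph.coe_neighborFinset, Set.ncard_coe_finset, 
      SimpleGraph.card_neighborFinset_eq_degree]
    exact (G.degree_le_maxDegree v).trans hcubic
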